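/- Let $n\in\mathbb N$ and let $\mathcal L(\mathbb C^{n\times n})$ be the space of all linear maps $\mathbb C^{n\times n}\to\mathbb C^{n\times n}$, equipped with the diamond norm $\|\Phi\|_\diamond:=\|\Phi\otimes\mathrm{id}_n\|_{1\to1}$, where $\|\Theta\|_{1\to 1}:=\sup_{\|A\|_1=1}\|\Theta(A)\|_1$ and $\|\cdot\|_1$ is the trace norm (sum of the singular values). For $S\subseteq\mathcal L(\mathbb C^{n\times n})$ let $\mathsf L(S):=\{A\in\mathcal L(\mathbb C^{n\times n}): e^{tA}\in S\text{ for all }t\ge 0\}$, and let $\mathsf M(S)$ be the set of all $\Phi\in S$ such that for every $\varepsilon>0$ there are finitely many $L_1,\dots,L_m\in\mathsf L(S)$ with $\|\Phi-e^{L_1}\cdots e^{L_m}\|_\diamond<\varepsilon$. Let $\mathsf{CPTP}(n)$ be the set of completely positive trace-preserving maps and $\mathsf{PTP}(n)$ the set of positive trace-preserving maps in $\mathcal L(\mathbb C^{n\times n})$. The elements of $\mathsf{MCPTP}(n):=\mathsf M(\mathsf{CPTP}(n))$ are called time-dependent Markovian channels. A linear map has only simple eigenvalues if each of its eigenvalues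 has algebraic multiplicity $1$. **Theorem.** For every $\Phi\in\mathsf{MCPTP}(n)$ and every $\varepsilon>0$ there exists $\Phi_\varepsilon\in\mathsf{MCPTP}(n)$ which has only simple eigenvalues such that $\|\Phi-\Phi_\varepsilon\|_\diamond<\varepsilon$. More generally, let $S\subseteq\mathcal L(\mathbb C^{n\times n})$ be any closed convex set that is closed under composition and contains the identity as well as the linear map $\Psi$ defined by $$\Psi(|j\rangle\langle k|):=\begin{cases}\sum_{l=1}^nA_{lj}|l\rangle\langle l|&j=k\\ \frac{i}{2^j3^k}|j\rangle\langle k|&j<k\\ -\frac{i}{2^k3^j}|j\rangle\langle k|&j>k\end{cases}\qquad(j,k=1,\dots,n),$$ where $A:=\frac12(\mathbf 1+C)$ and $C:=\sum_{j=1}^n|j\rangle\langle j+1|$ with $|n+1\rangle:=|1\rangle$. Then for every $\Phi\in\mathsf M(S)$ and every $\varepsilon>0$ there exists $\Phi_\varepsilon\in\mathsf M(S)$ which has only simple eigenvalues such that $\|\Phi-\Phi_\varepsilon\|_\diamond<\varepsilon$. In particular, this holds for $S=\mathsf{PTP}(n)$ and for the set $S$ of unital channels, i.e. of all $\Phi\in\mathsf{CPTP}(n)$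 with $\Phi(\mathbf 1)=\mathbf 1$. -/

import Mathlib

open scoped Kronecker Matrix ComplexOrder

noncomputable section

namespace QChannel

/-- The complex square matrices with index set `ι`. -/
abbrev Mat (ι : Type) : Type := Matrix ι ι ℂ

/-- The algebra of all linear maps on `Mat ι`, with composition as product. -/
abbrev Op (ι : Type) [Fintype ι] [DecidableEq ι] : Type := Module.End ℂ (Mat ι)

section General

variable {ι : Type} [Fintype ι] [DecidableEq ι]

/-! ### Norms -/

/-- The trace norm `‖A‖₁`: the sum of all singular values of `A`. -/
def traceNorm (A : Mat ι) : ℝ :=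
  ∑ i ∈ Finset.range (Fintype.card ι), (Matrix.toEuclideanLin A).singularValues i

/-- The operator norm `‖Φ‖_{1→1}` with respect to the trace norm. -/
def oneToOneNorm (Φ : Op ι) : ℝ :=
  sSup {r : ℝ | ∃ A : Mat ι, traceNorm A = 1 ∧ r = traceNorm (Φ A)}

/-- The map `Φ ⊗ id_κ` on `Mat ι ⊗ Mat κ = Mat (ι × κ)`: it applies `Φ` to each of the blocks
`(i, j) ↦ X (i, k) (j, l)`. -/
def tensorId (κ : Type) [Fintype κ] [DecidableEq κ] (Φ : Op ι) : Op (ι × κ) where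
  toFun X := Matrix.of fun p q =>
    Φ (Matrix.of fun i j => X (i, p.2) (j, q.2)) p.1 q.1
  map_add' X Y := by
    ext p q
    have h : (Matrix.of fun i j => (X + Y) (i, p.2) (j, q.2) : Mat ι) =
        (Matrix.of fun i j => X (i, p.2) (j, q.2)) +
          (Matrix.of fun i j => Y (i, p.2) (j, q.2)) := by
      ext i j; simp
    rw [Matrix.of_apply, h, map_add]
    rfl
  map_smul' c X := by
    ext p q
    have h : (Matrix.of fun i j => (c • X) (i, p.2) (j, q.2) : Mat ι) =
        c • (Matrix.of fun i j => X (i, p.2) (j, q.2)) := by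
      ext i j; simp
    rw [Matrix.of_apply, h, map_smul]
    rfl

/-- On elementary tensors, `(Φ ⊗ id) (A ⊗ B) = Φ A ⊗ B`. -/
theorem tensorId_kronecker (κ : Type) [Fintype κ] [DecidableEq κ] (Φ : Op ι)
    (A : Mat ι) (B : Mat κ) : tensorId κ Φ (A ⊗ₖ B) = (Φ A) ⊗ₖ B := by
  ext p q
  have h : (Matrix.of fun i j => (A ⊗ₖ B) (i, p.2) (j, q.2) : Mat ι) = B p.2 q.2 • A := by
    ext i j; simp [Matrix.kroneckerMap_apply, mul_comm]
  change Φ (Matrix.of fun i j => (A ⊗ₖ B) (i, p.2) (j, q.2)) p.1 q.1 = _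
  rw [h]
  simp [Matrix.kroneckerMap_apply, mul_comm]

/-- The diamond norm `‖Φ‖_⋄ = ‖Φ ⊗ id_n‖_{1→1}`, where `Φ` acts on `n × n` matrices. -/
def diamondNorm (Φ : Op ι) : ℝ := oneToOneNorm (tensorId ι Φ)

/-! ### Eigenvalues -/

/-- Every eigenvalue of `Φ` has algebraic multiplicity one. -/
def HasOnlySimpleEigenvalues (Φ : Op ι) : Prop :=
  ∀ μ : ℂ, Φ.HasEigenvalue μ → (LinearMap.charpoly Φ).rootMultiplicity μ = 1

/-! ### The exponential -/

/-- The exponential `e^L` of a linear map `L`, computed in the basis of matrix units; see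
`hasSum_expOp` for the power series. -/
def expOp (L : Op ι) : Op ι :=
  (LinearMap.toMatrixAlgEquiv (Matrix.stdBasis ℂ ι ι)).symm
    (NormedSpace.exp (LinearMap.toMatrixAlgEquiv (Matrix.stdBasis ℂ ι ι) L))

theorem hasSum_expOp (L : Op ι) (X : Mat ι) :
    HasSum (fun k : ℕ => ((k.factorial : ℂ)⁻¹) • (L ^ k) X) (expOp L X) := by
  let _ : NormedRing (Matrix (ι × ι) (ι × ι) ℂ) := Matrix.linftyOpNormedRing
  let _ : NormedAlgebra ℂ (Matrix (ι × ι) (ι × ι) ℂ) := Matrix.linftyOpNormedAlgebra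
  let e := LinearMap.toMatrixAlgEquiv (Matrix.stdBasis ℂ ι ι)
  let ev : Matrix (ι × ι) (ι × ι) ℂ →ₗ[ℂ] Mat ι :=
    (LinearMap.applyₗ X).comp e.symm.toLinearMap
  have hev : Continuous ev := LinearMap.continuous_of_finiteDimensional ev
  have h := (NormedSpace.exp_series_hasSum_exp' (𝕂 := ℂ) (e L)).map ev hev
  have hk : (fun k : ℕ => ((k.factorial : ℂ)⁻¹) • (L ^ k) X) =
      ev ∘ fun k : ℕ => ((k.factorial : ℂ)⁻¹) • e L ^ k := by
    funext k
    simp [ev, e, ← map_pow]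
  rw [hk]
  exact h

/-! ### Semigroups of maps and their Markovian elements -/

/-- The set `S` is closed. (All norms on the finite-dimensional space `Op ι` are equivalent.) -/
def IsNormClosed (S : Set (Op ι)) : Prop :=
  ∀ Φ : Op ι, (∀ ε : ℝ, 0 < ε → ∃ Θ ∈ S, diamondNorm (Φ - Θ) < ε) → Φ ∈ S

/-- The Lie wedge `{A | e^{tA} ∈ S for all t ≥ 0}` of `S`. -/
def lieWedge (S : Set (Op ι)) : Set (Op ι) :=
  {A | ∀ t : ℝ, 0 ≤ t → expOp ((t : ℂ) • A) ∈ S}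

/-- The time-dependent Markovian elements of `S`: the `Φ ∈ S` which can be approximated in
diamond norm by finite products `e^{L₁} ⋯ e^{Lₘ}` with all `Lⱼ` in the Lie wedge of `S`. -/
def timeDependentMarkovian (S : Set (Op ι)) : Set (Op ι) :=
  {Φ | Φ ∈ S ∧ ∀ ε : ℝ, 0 < ε → ∃ Ls : List (Op ι),
    (∀ L ∈ Ls, L ∈ lieWedge S) ∧ diamondNorm (Φ - (Ls.map expOp).prod) < ε}

/-! ### Positivity, complete positivity, trace preservation -/

/-- `Φ` maps positive semidefinite matrices to positive semidefinite matrices. -/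
def IsPositiveMap (Φ : Op ι) : Prop :=
  ∀ A : Mat ι, A.PosSemidef → (Φ A).PosSemidef

/-- `Φ ⊗ id_k` is positive for all `k`. -/
def IsCompletelyPositive (Φ : Op ι) : Prop :=
  ∀ k : ℕ, IsPositiveMap (tensorId (Fin k) Φ)

def IsTracePreserving (Φ : Op ι) : Prop :=
  ∀ A : Mat ι, (Φ A).trace = A.trace

end General

/-- The positive trace-preserving maps on `n × n` matrices. -/
def PTP (n : ℕ) : Set (Op (Fin n)) :=
  {Φ | IsPositiveMap Φ ∧ IsTracePreserving Φ}

/-- The completely positive trace-preserving maps (quantum channels) on `n × n` matrices. -/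
def CPTP (n : ℕ) : Set (Op (Fin n)) :=
  {Φ | IsCompletelyPositive Φ ∧ IsTracePreserving Φ}

/-- The unital quantum channels on `n × n` matrices. -/
def UnitalCPTP (n : ℕ) : Set (Op (Fin n)) :=
  {Φ | Φ ∈ CPTP n ∧ Φ 1 = 1}

/-- The time-dependent Markovian channels on `n × n` matrices. -/
def MCPTP (n : ℕ) : Set (Op (Fin n)) := timeDependentMarkovian (CPTP n)

/-! ### The channel `Ψ` -/

/-- The cyclic shift `C = ∑ⱼ |j⟩⟨j+1|` with `|n+1⟩ = |1⟩`. -/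
def cyclicShift (n : ℕ) : Mat (Fin n) :=
  Matrix.of fun j k => if finRotate n j = k then 1 else 0

/-- The matrix `A = (1 + C) / 2`. -/
def shiftAverage (n : ℕ) : Mat (Fin n) := (1 / 2 : ℂ) • (1 + cyclicShift n)

/-- The linear map `Ψ` with `Ψ(|j⟩⟨j|) = ∑ₗ A_{lj} |l⟩⟨l|`, and
`Ψ(|j⟩⟨k|) = i / (2^j 3^k) |j⟩⟨k|` for `j < k`, `Ψ(|j⟩⟨k|) = -i / (2^k 3^j) |j⟩⟨k|` for `j > k`.
Here `j, k` run through `1, …, n`, whereas `Fin n` starts at `0`, whence the shifted exponents. -/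
def Psi (n : ℕ) : Op (Fin n) where
  toFun X := Matrix.of fun j k =>
    if j = k then ∑ m, shiftAverage n j m * X m m
    else if j < k then
      Complex.I / ((2 : ℂ) ^ (j.val + 1) * (3 : ℂ) ^ (k.val + 1)) * X j k
    else
      -Complex.I / ((2 : ℂ) ^ (k.val + 1) * (3 : ℂ) ^ (j.val + 1)) * X j k
  map_add' X Y := by
    ext j k
    simp only [Matrix.of_apply, Matrix.add_apply]
    split_ifs
    · simp only [mul_add, Finset.sum_add_distrib]
    · ring
    · ring
  map_smul' c X := by
    ext j k
    simp only [Matrix.of_apply, Matrix.smul_apply, smul_eq_mul, RingHom.id_apply]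
    split_ifs
    · rw [Finset.mul_sum]
      exact Finset.sum_congr rfl fun m _ => by ring
    · ring
    · ring

end QChannel

end

/-!
The theorem is a perturbation argument along an analytic path inside the semigroup `S`. If `Ψ ∈ S`,
then `Ψ - 1` lies in the Lie wedge of `S`, because `e^{t(Ψ - 1)} = e^{-t} ∑ tᵏ Ψᵏ / k!` is a limit
of convex combinations of powers of `Ψ` (`sub_one_mem_lieWedge`). Given `Φ`, approximated by
`e^{L₁} ⋯ e^{Lₘ}`, the path
`M(t) = e^{(1-t)L₁} ⋯ e^{(1-t)Lₘ} e^{t(Ψ - 1)}` consists for `0 ≤ t ≤ 1` of time-dependent Markovian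
elements, starts at the approximant and ends at `e^{Ψ - 1}`. The discriminant of the characteristic
polynomial of `M(t)` is an entire function of `t`. It does not vanish at `t = 1`, so its zeros are
isolated, and `M(t)` has only simple eigenvalues for all sufficiently small `t > 0`
(`exists_hasOnlySimpleEigenvalues_of_mem_lieWedge`).

That `e^{Ψ - 1}` has simple spectrum (`separable_charpoly_expOp_Psi_sub_one`) follows from an
explicit eigenbasis of `Ψ`: the discrete Fourier basis on the diagonal matrices, with eigenvalues
`(1 + ωʲ) / 2`, and the off-diagonal matrix units, with the eigenvalues `± i / (2ʲ 3ᵏ)`. These are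
pairwise distinct and lie in the closed unit disc, where `exp` is injective.

Finally `Ψ` is a unital channel: it is the sum of a Schur multiplication by a Hermitian diagonally
dominant matrix and half of the map which shifts the diagonal and deletes the rest
(`tensorId_Psi`), so that complete positivity follows from the Schur product theorem.

The comparison between diamond norm and pointwise convergence, and the triangle inequality, rest on
a variational description of the trace norm (`sum_norm_inner_le_traceNorm`).
-/

open scoped Matrix ComplexOrder

noncomputable section

namespace QChannel

open Filter Topology

/-! ### The trace norm -/

/-- A finite family of vectors satisfying Bessel's inequality. Such families replace orthonormal
ones below because the left singular vectors belonging to the singular value `0` are taken to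
be `0`. -/
def IsBessel {κ E : Type*} [Fintype κ] [NormedAddCommGroup E] [InnerProductSpace ℂ E]
    (u : κ → E) : Prop :=
  ∀ x, ∑ k, ‖inner ℂ (u k) x‖ ^ 2 ≤ ‖x‖ ^ 2

section Bessel

variable {κ E : Type*} [Fintype κ] [NormedAddCommGroup E] [InnerProductSpace ℂ E]

theorem isBessel_of_orthogonal {u : κ → E} (h0 : ∀ i j, i ≠ j → inner ℂ (u i) (u j) = 0)
    (h1 : ∀ i, u i ≠ 0 → ‖u i‖ = 1) : IsBessel u := by
  classical
  intro x
  have ho : Orthonormal ℂ (fun i : {i // u i ≠ 0} => u i) :=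
    ⟨fun i => h1 i i.2, fun i j hij => h0 i j fun h => hij (Subtype.ext h)⟩
  have hb := ho.sum_inner_products_le x (s := Finset.univ)
  refine le_trans (le_of_eq ?_) hb
  rw [← Finset.sum_filter_of_ne (p := fun k => u k ≠ 0)]
  · exact Finset.sum_subtype _ (by simp) _
  · intro k _ hk h
    simp [h] at hk

theorem isBessel_orthonormal {u : κ → E} (h : Orthonormal ℂ u) : IsBessel u :=
  fun x => h.sum_inner_products_le x (s := Finset.univ)

theorem IsBessel.sum_mul_le {u v : κ → E} (hu : IsBessel u) (hv : IsBessel v) (x y : E) :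
    ∑ k, ‖inner ℂ (u k) x‖ * ‖inner ℂ (v k) y‖ ≤ ‖x‖ * ‖y‖ := by
  have h := Finset.sum_mul_sq_le_sq_mul_sq Finset.univ (fun k => ‖inner ℂ (u k) x‖)
    (fun k => ‖inner ℂ (v k) y‖)
  refine le_of_sq_le_sq ?_ (by positivity)
  calc _ ≤ _ := h
    _ ≤ ‖x‖ ^ 2 * ‖y‖ ^ 2 :=
      mul_le_mul (hu x) (hv y) (by positivity) (by positivity)
    _ = _ := by ring

theorem IsBessel.norm_le_one {u : κ → E} (hu : IsBessel u) (k : κ) : ‖u k‖ ≤ 1 := by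
  have h := (Finset.single_le_sum (f := fun j => ‖inner ℂ (u j) (u k)‖ ^ 2)
    (fun j _ => by positivity) (Finset.mem_univ k)).trans (hu (u k))
  simp only [inner_self_eq_norm_sq_to_K, norm_pow, Complex.coe_algebraMap, Complex.norm_real,
    norm_norm] at h
  by_contra! hc
  nlinarith [sq_nonneg (‖u k‖), mul_pos (sub_pos.2 hc) (sub_pos.2 hc)]

end Bessel

/-- A singular value decomposition. The left singular vectors are orthonormal except for those
belonging to the singular value `0`, which are `0`. -/
theorem exists_svd {ι : Type} [Fintype ι] [DecidableEq ι] (A : Mat ι) :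
    ∃ (u v : Fin (Fintype.card ι) → EuclideanSpace ℂ ι), IsBessel u ∧ IsBessel v ∧
      (∀ k, inner ℂ (u k) (Matrix.toEuclideanLin A (v k)) =
        ((Matrix.toEuclideanLin A).singularValues k : ℂ)) ∧
      ∀ x, Matrix.toEuclideanLin A x =
        ∑ k : Fin (Fintype.card ι), inner ℂ (v k) x •
          (((Matrix.toEuclideanLin A).singularValues k : ℂ) • u k) := by
  set T := Matrix.toEuclideanLin A with hT
  have hn : Module.finrank ℂ (EuclideanSpace ℂ ι) = Fintype.card ι := finrank_euclideanSpace
  have hs := T.isSymmetric_adjoint_comp_self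
  let v := hs.eigenvectorBasis hn
  have hσ : ∀ k : Fin (Fintype.card ι), (hs.eigenvalues hn k : ℂ) =
      (T.singularValues k : ℂ) ^ 2 := fun k => by
    rw [← T.sq_singularValues_fin hn]; push_cast; rfl
  have hin : ∀ i j, inner ℂ (T (v i)) (T (v j)) =
      if i = j then (T.singularValues j : ℂ) ^ 2 else 0 := by
    intro i j
    have h1 := hs.apply_eigenvectorBasis hn j
    rw [← LinearMap.adjoint_inner_right, ← LinearMap.comp_apply, h1, inner_smul_right,
      orthonormal_iff_ite.1 v.orthonormal i j]
    split_ifs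
    · simpa using hσ j
    · simp
  have hz : ∀ k : Fin (Fintype.card ι), T.singularValues k = 0 → T (v k) = 0 := by
    intro k hk
    rw [← inner_self_eq_zero (𝕜 := ℂ), hin, if_pos rfl, hk]; simp
  let u : Fin (Fintype.card ι) → EuclideanSpace ℂ ι :=
    fun k => ((T.singularValues k : ℂ)⁻¹) • T (v k)
  have hu : ∀ k, T (v k) = (T.singularValues k : ℂ) • u k := by
    intro k
    by_cases hk : T.singularValues k = 0
    · simp [hz k hk, u]
    · have : (T.singularValues k : ℂ) ≠ 0 := by exact_mod_cast hk
      simp [u, smul_smul, this]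
  refine ⟨u, v, isBessel_of_orthogonal ?_ ?_, isBessel_orthonormal v.orthonormal, ?_, ?_⟩
  · intro i j hij
    rw [inner_smul_left, inner_smul_right, hin, if_neg hij, mul_zero, mul_zero]
  · intro i hi
    have hk : (T.singularValues i : ℂ) ≠ 0 := by
      intro h; exact hi (by simp [u, h])
    have : inner ℂ (u i) (u i) = (1 : ℂ) := by
      simp only [u, inner_smul_left, inner_smul_right, hin, if_true, map_inv₀, Complex.conj_ofReal]
      field_simp
    rw [inner_self_eq_norm_sq_to_K] at this
    have h2 : ‖u i‖ ^ 2 = 1 := by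
      apply Complex.ofReal_injective
      push_cast
      exact this
    nlinarith [norm_nonneg (u i)]
  · intro k
    simp only [u, inner_smul_left, hin, if_true, map_inv₀, Complex.conj_ofReal]
    by_cases hk : (T.singularValues k : ℂ) = 0
    · simp [hk]
    · field_simp
  · intro x
    conv_lhs => rw [← v.sum_repr x]
    simp only [map_sum, map_smul, v.repr_apply_apply]
    exact Finset.sum_congr rfl fun k _ => by rw [hu k]

variable {ι : Type} [Fintype ι] [DecidableEq ι]

theorem traceNorm_nonneg (A : Mat ι) : 0 ≤ traceNorm A :=
  Finset.sum_nonneg fun i _ => LinearMap.singularValues_nonneg _ i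

theorem traceNorm_eq_sum_fin (A : Mat ι) :
    traceNorm A = ∑ k : Fin (Fintype.card ι), (Matrix.toEuclideanLin A).singularValues k :=
  Finset.sum_range _

/-- The easy half of the variational characterization of the trace norm: no pair of Bessel
families does better than the singular vectors. -/
theorem sum_norm_inner_le_traceNorm {κ : Type*} [Fintype κ] {u v : κ → EuclideanSpace ℂ ι}
    (hu : IsBessel u) (hv : IsBessel v) (A : Mat ι) :
    ∑ k, ‖inner ℂ (u k) (Matrix.toEuclideanLin A (v k))‖ ≤ traceNorm A := by
  obtain ⟨a, b, ha, hb, -, h⟩ := exists_svd A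
  set σ := fun k : Fin (Fintype.card ι) => (Matrix.toEuclideanLin A).singularValues k with hσ
  have hσ0 : ∀ k, 0 ≤ σ k := fun k => LinearMap.singularValues_nonneg _ _
  calc ∑ k, ‖inner ℂ (u k) (Matrix.toEuclideanLin A (v k))‖
      ≤ ∑ k, ∑ l, σ l * (‖inner ℂ (u k) (a l)‖ * ‖inner ℂ (v k) (b l)‖) := by
        refine Finset.sum_le_sum fun k _ => ?_
        rw [h, inner_sum]
        refine (norm_sum_le _ _).trans (Finset.sum_le_sum fun l _ => le_of_eq ?_)
        rw [inner_smul_right, inner_smul_right, norm_mul, norm_mul, Complex.norm_real,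
          Real.norm_of_nonneg (hσ0 l), norm_inner_symm (b l)]
        ring
    _ = ∑ l, σ l * ∑ k, ‖inner ℂ (u k) (a l)‖ * ‖inner ℂ (v k) (b l)‖ := by
        rw [Finset.sum_comm]
        exact Finset.sum_congr rfl fun l _ => by rw [Finset.mul_sum]
    _ ≤ ∑ l, σ l * 1 := by
        refine Finset.sum_le_sum fun l _ => mul_le_mul_of_nonneg_left ?_ (hσ0 l)
        exact (hu.sum_mul_le hv _ _).trans
          (mul_le_one₀ (ha.norm_le_one l) (norm_nonneg _) (hb.norm_le_one l))
    _ = traceNorm A := by simp [traceNorm_eq_sum_fin, σ]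

/-- The trace norm is attained at the singular vectors. -/
theorem exists_sum_norm_inner_eq_traceNorm (A : Mat ι) :
    ∃ (u v : Fin (Fintype.card ι) → EuclideanSpace ℂ ι), IsBessel u ∧ IsBessel v ∧
      traceNorm A = ∑ k, ‖inner ℂ (u k) (Matrix.toEuclideanLin A (v k))‖ := by
  obtain ⟨u, v, hu, hv, h, -⟩ := exists_svd A
  refine ⟨u, v, hu, hv, ?_⟩
  rw [traceNorm_eq_sum_fin]
  refine Finset.sum_congr rfl fun k _ => ?_
  rw [h, Complex.norm_real, Real.norm_of_nonneg (LinearMap.singularValues_nonneg _ _)]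

theorem traceNorm_add_le (A B : Mat ι) : traceNorm (A + B) ≤ traceNorm A + traceNorm B := by
  obtain ⟨u, v, hu, hv, h⟩ := exists_sum_norm_inner_eq_traceNorm (A + B)
  rw [h]
  refine le_trans ?_ (add_le_add (sum_norm_inner_le_traceNorm hu hv A)
    (sum_norm_inner_le_traceNorm hu hv B))
  rw [← Finset.sum_add_distrib]
  refine Finset.sum_le_sum fun k _ => ?_
  rw [map_add, LinearMap.add_apply, inner_add_right]
  exact norm_add_le _ _

theorem toEuclideanLin_apply_single (A : Mat ι) (i j : ι) :
    inner ℂ (EuclideanSpace.single i (1 : ℂ))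
      (Matrix.toEuclideanLin A (EuclideanSpace.single j (1 : ℂ))) = A i j := by
  rw [Matrix.toLpLin_apply, EuclideanSpace.inner_single_left]
  simp

theorem norm_apply_le_traceNorm (A : Mat ι) (i j : ι) : ‖A i j‖ ≤ traceNorm A := by
  have hb : ∀ i : ι, IsBessel fun _ : Unit => EuclideanSpace.single i (1 : ℂ) := fun i =>
    isBessel_of_orthogonal (fun a b h => absurd (Subsingleton.elim a b) h) (by simp)
  simpa [toEuclideanLin_apply_single] using sum_norm_inner_le_traceNorm (hb i) (hb j) A

theorem traceNorm_le_sum_norm_apply (A : Mat ι) : traceNorm A ≤ ∑ i, ∑ j, ‖A i j‖ := by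
  obtain ⟨u, v, hu, hv, h⟩ := exists_sum_norm_inner_eq_traceNorm A
  rw [h]
  calc ∑ k, ‖inner ℂ (u k) (Matrix.toEuclideanLin A (v k))‖
      ≤ ∑ k, ∑ i, ∑ j, ‖A i j‖ * (‖u k i‖ * ‖v k j‖) := by
        refine Finset.sum_le_sum fun k _ => ?_
        have : inner ℂ (u k) (Matrix.toEuclideanLin A (v k)) =
            ∑ i, ∑ j, A i j * (star (u k i) * v k j) := by
          simp only [Matrix.toLpLin_apply, PiLp.inner_apply, RCLike.inner_apply,
            Matrix.mulVec, dotProduct, Finset.sum_mul]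
          refine Finset.sum_congr rfl fun i _ => Finset.sum_congr rfl fun j _ => ?_
          simp only [RCLike.star_def]; ring
        rw [this]
        refine (norm_sum_le _ _).trans (Finset.sum_le_sum fun i _ => ?_)
        refine (norm_sum_le _ _).trans (Finset.sum_le_sum fun j _ => le_of_eq ?_)
        rw [norm_mul, norm_mul, norm_star]
    _ = ∑ i, ∑ j, ‖A i j‖ * ∑ k, ‖u k i‖ * ‖v k j‖ := by
        rw [Finset.sum_comm]
        refine Finset.sum_congr rfl fun i _ => ?_
        rw [Finset.sum_comm]
        exact Finset.sum_congr rfl fun j _ => by rw [Finset.mul_sum]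
    _ ≤ ∑ i, ∑ j, ‖A i j‖ * 1 := by
        refine Finset.sum_le_sum fun i _ => Finset.sum_le_sum fun j _ =>
          mul_le_mul_of_nonneg_left ?_ (norm_nonneg _)
        have := hu.sum_mul_le hv (EuclideanSpace.single i (1 : ℂ)) (EuclideanSpace.single j (1 : ℂ))
        simpa [EuclideanSpace.inner_single_right] using this
    _ = _ := by simp

theorem traceNorm_single (i j : ι) : traceNorm (Matrix.single i j (1 : ℂ) : Mat ι) = 1 := by
  refine le_antisymm ((traceNorm_le_sum_norm_apply _).trans (le_of_eq ?_)) ?_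
  · rw [Finset.sum_eq_single i, Finset.sum_eq_single j]
    · simp
    · intro b _ hb; simp [hb.symm]
    · simp
    · intro b _ hb; simp [hb.symm]
    · simp
  · simpa using norm_apply_le_traceNorm (Matrix.single i j (1 : ℂ) : Mat ι) i j

/-! ### The diamond norm -/

theorem apply_eq_sum_single (Φ : Op ι) (A : Mat ι) (k l : ι) :
    Φ A k l = ∑ i, ∑ j, A i j * Φ (Matrix.single i j 1) k l := by
  conv_lhs => rw [Matrix.matrix_eq_sum_single A]
  simp only [map_sum, Matrix.sum_apply]
  refine Finset.sum_congr rfl fun i _ => Finset.sum_congr rfl fun j _ => ?_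
  rw [show (Matrix.single i j (A i j) : Mat ι) = A i j • Matrix.single i j 1 by simp, map_smul]
  rfl

/-- The sum of the moduli of all matrix entries of `Φ`; it bounds `‖Φ‖_{1→1}`. -/
def entrySum (Φ : Op ι) : ℝ :=
  ∑ k, ∑ l, ∑ i, ∑ j, ‖Φ (Matrix.single i j 1) k l‖

theorem traceNorm_apply_le (Φ : Op ι) {A : Mat ι} (hA : traceNorm A = 1) :
    traceNorm (Φ A) ≤ entrySum Φ := by
  refine (traceNorm_le_sum_norm_apply _).trans ?_
  refine Finset.sum_le_sum fun k _ => Finset.sum_le_sum fun l _ => ?_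
  rw [apply_eq_sum_single]
  refine (norm_sum_le _ _).trans (Finset.sum_le_sum fun i _ => ?_)
  refine (norm_sum_le _ _).trans (Finset.sum_le_sum fun j _ => ?_)
  rw [norm_mul]
  exact mul_le_of_le_one_left (norm_nonneg _) (hA ▸ norm_apply_le_traceNorm A i j)

theorem traceNorm_apply_le_oneToOneNorm (Φ : Op ι) {A : Mat ι} (hA : traceNorm A = 1) :
    traceNorm (Φ A) ≤ oneToOneNorm Φ :=
  le_csSup ⟨entrySum Φ, by rintro r ⟨B, hB, rfl⟩; exact traceNorm_apply_le Φ hB⟩ ⟨A, hA, rfl⟩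

theorem oneToOneNorm_nonneg (Φ : Op ι) : 0 ≤ oneToOneNorm Φ :=
  Real.sSup_nonneg (by rintro r ⟨A, -, rfl⟩; exact traceNorm_nonneg _)

theorem entrySum_nonneg (Φ : Op ι) : 0 ≤ entrySum Φ := by unfold entrySum; positivity

theorem oneToOneNorm_le_entrySum (Φ : Op ι) : oneToOneNorm Φ ≤ entrySum Φ :=
  Real.sSup_le (by rintro r ⟨A, hA, rfl⟩; exact traceNorm_apply_le Φ hA) (entrySum_nonneg Φ)

theorem oneToOneNorm_add_le (Φ Θ : Op ι) :
    oneToOneNorm (Φ + Θ) ≤ oneToOneNorm Φ + oneToOneNorm Θ := by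
  refine Real.sSup_le ?_ (add_nonneg (oneToOneNorm_nonneg _) (oneToOneNorm_nonneg _))
  rintro r ⟨A, hA, rfl⟩
  exact (traceNorm_add_le _ _).trans (add_le_add (traceNorm_apply_le_oneToOneNorm Φ hA)
    (traceNorm_apply_le_oneToOneNorm Θ hA))

theorem tensorId_apply (κ : Type) [Fintype κ] [DecidableEq κ] (Φ : Op ι) (X : Mat (ι × κ))
    (p q : ι × κ) :
    tensorId κ Φ X p q = Φ (Matrix.of fun i j => X (i, p.2) (j, q.2)) p.1 q.1 := rfl

theorem tensorId_add (κ : Type) [Fintype κ] [DecidableEq κ] (Φ Θ : Op ι) :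
    tensorId κ (Φ + Θ) = tensorId κ Φ + tensorId κ Θ := by
  ext1 X
  rfl

theorem diamondNorm_add_le (Φ Θ : Op ι) :
    diamondNorm (Φ + Θ) ≤ diamondNorm Φ + diamondNorm Θ := by
  unfold diamondNorm
  rw [tensorId_add]
  exact oneToOneNorm_add_le _ _

theorem diamondNorm_nonneg (Φ : Op ι) : 0 ≤ diamondNorm Φ := oneToOneNorm_nonneg _

/-- Evaluating `Φ ⊗ id` at the matrix unit `|i⟩⟨j| ⊗ |i⟩⟨i|`, which has trace norm `1`. -/
theorem norm_apply_single_le_diamondNorm (Φ : Op ι) (i j k l : ι) :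
    ‖Φ (Matrix.single i j 1) k l‖ ≤ diamondNorm Φ := by
  have h1 := traceNorm_apply_le_oneToOneNorm (tensorId ι Φ)
    (traceNorm_single ((i, i) : ι × ι) (j, i))
  refine le_trans (le_trans (le_of_eq ?_) (norm_apply_le_traceNorm _ (k, i) (l, i))) h1
  rw [tensorId_apply]
  have : (Matrix.of fun a b => Matrix.single ((i, i) : ι × ι) (j, i) (1 : ℂ) (a, i) (b, i)) =
      (Matrix.single i j 1 : Mat ι) := by
    ext a b
    simp [Matrix.single_apply]
  rw [this]

/-- Pointwise convergence implies convergence in diamond norm. -/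
theorem tendsto_diamondNorm_sub {α : Type*} {l : Filter α} {f : α → Op ι} {Φ : Op ι}
    (h : ∀ X i j, Tendsto (fun a => f a X i j) l (𝓝 (Φ X i j))) :
    Tendsto (fun a => diamondNorm (Φ - f a)) l (𝓝 0) := by
  refine squeeze_zero (fun _ => diamondNorm_nonneg _) (fun a => oneToOneNorm_le_entrySum _) ?_
  unfold entrySum
  have h0 : (0 : ℝ) = ∑ _k : ι × ι, ∑ _l : ι × ι, ∑ _i : ι × ι, ∑ _j : ι × ι, ‖(0 : ℂ)‖ := by simp
  rw [h0]
  refine tendsto_finsetSum _ fun k _ => tendsto_finsetSum _ fun l _ =>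
    tendsto_finsetSum _ fun i _ => tendsto_finsetSum _ fun j _ => Tendsto.norm ?_
  simp only [tensorId_apply, LinearMap.sub_apply, Matrix.sub_apply]
  have := (h (Matrix.of fun a b => Matrix.single i j (1 : ℂ) (a, k.2) (b, l.2)) k.1 l.1).const_sub
    (Φ (Matrix.of fun a b => Matrix.single i j (1 : ℂ) (a, k.2) (b, l.2)) k.1 l.1)
  rwa [sub_self] at this

/-- Convergence in diamond norm implies pointwise convergence. -/
theorem tendsto_apply_of_tendsto_diamondNorm {α : Type*} {l : Filter α} {f : α → Op ι} {Φ : Op ι}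
    (h : Tendsto (fun a => diamondNorm (Φ - f a)) l (𝓝 0)) (X : Mat ι) (i j : ι) :
    Tendsto (fun a => f a X i j) l (𝓝 (Φ X i j)) := by
  simp only [apply_eq_sum_single _ X]
  refine tendsto_finsetSum _ fun k _ => tendsto_finsetSum _ fun m _ => Tendsto.const_mul _ ?_
  rw [tendsto_iff_norm_sub_tendsto_zero]
  refine squeeze_zero (fun _ => norm_nonneg _) (fun a => ?_) h
  rw [norm_sub_rev]
  exact norm_apply_single_le_diamondNorm (Φ - f a) k m i j

/-- A set is closed if it contains all its pointwise sequential limits. -/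
theorem isNormClosed_of_seq {S : Set (Op ι)}
    (h : ∀ (f : ℕ → Op ι) (Φ : Op ι), (∀ m, f m ∈ S) →
      (∀ X i j, Tendsto (fun m => f m X i j) atTop (𝓝 (Φ X i j))) → Φ ∈ S) :
    IsNormClosed S := by
  intro Φ hΦ
  choose f hf hlt using fun m : ℕ => hΦ (1 / ((m : ℝ) + 1)) (by positivity)
  refine h f Φ hf (tendsto_apply_of_tendsto_diamondNorm ?_)
  exact squeeze_zero (fun _ => diamondNorm_nonneg _) (fun m => (hlt m).le)
    tendsto_one_div_add_atTop_nhds_zero_nat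

theorem IsNormClosed.mem_of_tendsto {S : Set (Op ι)} (hS : IsNormClosed S) {f : ℕ → Op ι}
    {Φ : Op ι} (hf : ∀ m, f m ∈ S)
    (h : ∀ X i j, Tendsto (fun m => f m X i j) atTop (𝓝 (Φ X i j))) : Φ ∈ S := by
  refine hS Φ fun ε hε => ?_
  obtain ⟨m, hm⟩ := ((tendsto_diamondNorm_sub h).eventually (gt_mem_nhds hε)).exists
  exact ⟨f m, hf m, hm⟩

/-! ### Matrices with simple spectrum -/

section Separable

variable {κ : Type*} [Fintype κ] [DecidableEq κ]

/-- The discriminant of the characteristic polynomial is a polynomial in the matrix entries. -/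
theorem exists_mvPolynomial_eval_eq_zero_iff_not_separable_charpoly (κ : Type*) [Fintype κ]
    [DecidableEq κ] :
    ∃ P : MvPolynomial (κ × κ) ℂ, ∀ M : Matrix κ κ ℂ,
      MvPolynomial.eval (fun p => M p.1 p.2) P = 0 ↔ ¬ M.charpoly.Separable := by
  -- the resultant of the universal characteristic polynomial and its derivative, in degrees fixed
  -- in advance so that it is compatible with specialization
  set U := Matrix.charpoly.univ ℂ κ
  refine ⟨Polynomial.resultant U (Polynomial.derivative U) (Fintype.card κ)
    (Fintype.card κ - 1), fun M => ?_⟩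
  have hU : U.map (MvPolynomial.eval fun p => M p.1 p.2) = M.charpoly :=
    Matrix.charpoly.univ_map_eval₂Hom κ (RingHom.id ℂ) fun p => M p.1 p.2
  rw [← Polynomial.resultant_map_map, ← Polynomial.derivative_map, hU]
  have h1 : M.charpoly.natDegree = Fintype.card κ := M.charpoly_natDegree_eq_dim
  have h2 : (Polynomial.derivative M.charpoly).natDegree = Fintype.card κ - 1 := by
    rw [Polynomial.natDegree_derivative, h1]
  have h3 : M.charpoly ≠ 0 := M.charpoly_monic.ne_zero
  have := Polynomial.resultant_eq_zero_iff (f := M.charpoly)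
    (g := Polynomial.derivative M.charpoly)
  rw [h1, h2] at this
  rw [this, Polynomial.Separable]
  simp [h3]

theorem differentiable_mvPolynomial_eval {σ : Type*} (P : MvPolynomial σ ℂ) {F : ℂ → σ → ℂ}
    (hF : ∀ s, Differentiable ℂ fun t => F t s) :
    Differentiable ℂ fun t => MvPolynomial.eval (F t) P := by
  induction P using MvPolynomial.induction_on with
  | C a => simp
  | add p q hp hq => simp only [map_add]; exact hp.add hq
  | mul_X p s hp => simp only [map_mul, MvPolynomial.eval_X]; exact hp.mul (hF s)

/-- An entire matrix-valued function with simple spectrum at one point has simple spectrum at all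
points of some punctured neighbourhood of any given point. -/
theorem eventually_separable_charpoly {F : ℂ → Matrix κ κ ℂ}
    (hF : ∀ i j, Differentiable ℂ fun t => F t i j) {t₁ : ℂ} (h₁ : (F t₁).charpoly.Separable)
    (t₀ : ℂ) : ∀ᶠ t in 𝓝[≠] t₀, (F t).charpoly.Separable := by
  obtain ⟨P, hP⟩ := exists_mvPolynomial_eval_eq_zero_iff_not_separable_charpoly κ
  have hd := differentiable_mvPolynomial_eval P (F := fun t p => F t p.1 p.2) fun p => hF p.1 p.2
  have ha : AnalyticOnNhd ℂ (fun t => MvPolynomial.eval (fun p => F t p.1 p.2) P) Set.univ :=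
    hd.differentiableOn.analyticOnNhd isOpen_univ
  by_contra hne
  have hfr : ∃ᶠ t in 𝓝[≠] t₀, MvPolynomial.eval (fun p => F t p.1 p.2) P = 0 := by
    rw [not_eventually] at hne
    exact hne.mono fun t ht => (hP _).2 ht
  exact (hP _).1 (ha.eqOn_zero_of_preconnected_of_frequently_eq_zero isPreconnected_univ
    (Set.mem_univ t₀) hfr (Set.mem_univ t₁)) h₁

end Separable

variable {ι : Type} [Fintype ι] [DecidableEq ι]

/-- The matrix of a linear map in the basis of matrix units. -/
abbrev opMatrix : Op ι ≃ₐ[ℂ] Matrix (ι × ι) (ι × ι) ℂ :=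
  LinearMap.toMatrixAlgEquiv (Matrix.stdBasis ℂ ι ι)

theorem charpoly_opMatrix (Φ : Op ι) : (opMatrix Φ).charpoly = LinearMap.charpoly Φ :=
  LinearMap.charpoly_toMatrix Φ (Matrix.stdBasis ℂ ι ι)

theorem hasOnlySimpleEigenvalues_of_separable {Φ : Op ι}
    (h : (LinearMap.charpoly Φ).Separable) : HasOnlySimpleEigenvalues Φ := by
  intro μ hμ
  refine le_antisymm (Polynomial.rootMultiplicity_le_one_of_separable h μ) ?_
  rw [Nat.one_le_iff_ne_zero, ← Nat.pos_iff_ne_zero,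
    Polynomial.rootMultiplicity_pos (LinearMap.charpoly_monic Φ).ne_zero]
  exact (Module.End.hasEigenvalue_iff_isRoot_charpoly Φ μ).1 hμ

theorem opMatrix_expOp (L : Op ι) : opMatrix (expOp L) = NormedSpace.exp (opMatrix L) :=
  opMatrix.apply_symm_apply _

theorem expOp_zero : expOp (0 : Op ι) = 1 := by
  apply opMatrix.injective
  rw [opMatrix_expOp, map_zero, map_one, NormedSpace.exp_zero]

theorem continuous_opMatrix_symm_apply (X : Mat ι) (i j : ι) :
    Continuous fun M : Matrix (ι × ι) (ι × ι) ℂ => opMatrix.symm M X i j := by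
  let f : Matrix (ι × ι) (ι × ι) ℂ →ₗ[ℂ] ℂ :=
    (Matrix.entryLinearMap ℂ ℂ i j).comp
      ((LinearMap.applyₗ X).comp opMatrix.symm.toLinearMap)
  exact LinearMap.continuous_of_finiteDimensional f

/-! ### The deformation towards a simple generator -/

/-- The path `t ↦ e^{(1-t)L₁} ⋯ e^{(1-t)Lₘ} e^{tΛ}` from `e^{L₁} ⋯ e^{Lₘ}` to `e^Λ`. -/
def expPath (Ls : List (Op ι)) (Λ : Op ι) (t : ℂ) : Op ι :=
  (Ls.map fun L => expOp ((1 - t) • L)).prod * expOp (t • Λ)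

theorem expPath_zero (Ls : List (Op ι)) (Λ : Op ι) :
    expPath Ls Λ 0 = (Ls.map expOp).prod := by
  simp [expPath, expOp_zero]

theorem expPath_one (Ls : List (Op ι)) (Λ : Op ι) : expPath Ls Λ 1 = expOp Λ := by
  have : (Ls.map fun _ => (1 : Op ι)).prod = 1 := by simp
  simp [expPath, expOp_zero, -List.map_const', this]

section Normed

attribute [local instance] Matrix.linftyOpNormedRing Matrix.linftyOpNormedAlgebra

theorem differentiable_exp_smul {κ : Type*} [Fintype κ] [DecidableEq κ] (M : Matrix κ κ ℂ) :
    Differentiable ℂ fun t : ℂ => NormedSpace.exp (t • M) :=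
  fun t => (hasDerivAt_exp_smul_const M t).differentiableAt

theorem differentiable_opMatrix_expPath (Ls : List (Op ι)) (Λ : Op ι) :
    Differentiable ℂ fun t => opMatrix (expPath Ls Λ t) := by
  have hd : Differentiable ℂ fun t : ℂ => opMatrix (Ls.map fun L => expOp ((1 - t) • L)).prod := by
    induction Ls with
    | nil => simp
    | cons L Ls ih =>
      simp only [List.map_cons, List.prod_cons, map_mul]
      refine Differentiable.mul ?_ ih
      simp only [opMatrix_expOp, map_smul]
      exact (differentiable_exp_smul (opMatrix L)).comp (by fun_prop)
  simp only [expPath, map_mul]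
  refine hd.mul ?_
  simp only [opMatrix_expOp, map_smul]
  exact differentiable_exp_smul (opMatrix Λ)

theorem differentiable_opMatrix_expPath_apply (Ls : List (Op ι)) (Λ : Op ι) (p q : ι × ι) :
    Differentiable ℂ fun t => opMatrix (expPath Ls Λ t) p q := by
  have h := (LinearMap.toContinuousLinearMap
    (Matrix.entryLinearMap ℂ ℂ p q : Matrix (ι × ι) (ι × ι) ℂ →ₗ[ℂ] ℂ)).differentiable.comp
    (differentiable_opMatrix_expPath Ls Λ)
  exact h

theorem expOp_smul_sub_one (Φ : Op ι) (t : ℂ) :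
    expOp (t • (Φ - 1)) = Complex.exp (-t) • expOp (t • Φ) := by
  apply opMatrix.injective
  have h : opMatrix (t • (Φ - 1)) = opMatrix (t • Φ) + algebraMap ℂ _ (-t) := by
    rw [Algebra.algebraMap_eq_smul_one, smul_sub, map_sub, map_smul opMatrix t 1, map_one]
    module
  have hexp : NormedSpace.exp (algebraMap ℂ (Matrix (ι × ι) (ι × ι) ℂ) (-t)) =
      algebraMap ℂ _ (Complex.exp (-t)) := by
    rw [Complex.exp_eq_exp_ℂ]
    exact (NormedSpace.algebraMap_exp_comm (-t)).symm
  rw [opMatrix_expOp, h, Matrix.exp_add_of_commute _ _ (Algebra.commute_algebraMap_right _ _),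
    hexp, map_smul opMatrix (Complex.exp (-t)), opMatrix_expOp, map_smul,
    ← Algebra.commutes]
  exact (Algebra.smul_def _ _).symm

end Normed

theorem continuous_expPath_apply (Ls : List (Op ι)) (Λ : Op ι) (X : Mat ι) (i j : ι) :
    Continuous fun t => expPath Ls Λ t X i j := by
  have hc : Continuous fun t => opMatrix (expPath Ls Λ t) :=
    continuous_matrix fun p q => (differentiable_opMatrix_expPath_apply Ls Λ p q).continuous
  refine ((continuous_opMatrix_symm_apply X i j).comp hc).congr fun t => ?_
  rw [Function.comp_apply, AlgEquiv.symm_apply_apply]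

theorem smul_mem_lieWedge {S : Set (Op ι)} {L : Op ι} (hL : L ∈ lieWedge S) {s : ℝ}
    (hs : 0 ≤ s) : (s : ℂ) • L ∈ lieWedge S := by
  intro t ht
  have := hL (t * s) (mul_nonneg ht hs)
  rwa [Complex.ofReal_mul, mul_smul] at this

theorem prod_expOp_mem_timeDependentMarkovian {S : Set (Op ι)} (h1 : (1 : Op ι) ∈ S)
    (hmul : ∀ Φ₁ ∈ S, ∀ Φ₂ ∈ S, Φ₁ * Φ₂ ∈ S) {Ls : List (Op ι)} (hL : ∀ L ∈ Ls, L ∈ lieWedge S) :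
    (Ls.map expOp).prod ∈ timeDependentMarkovian S := by
  refine ⟨?_, fun ε hε => ⟨Ls, hL, ?_⟩⟩
  · induction Ls with
    | nil => simpa
    | cons L Ls ih =>
      simp only [List.map_cons, List.prod_cons]
      refine hmul _ ?_ _ (ih fun L h => hL L (List.mem_cons_of_mem _ h))
      simpa using hL L List.mem_cons_self 1 zero_le_one
  · have h0 : diamondNorm (0 : Op ι) ≤ 0 :=
      (oneToOneNorm_le_entrySum _).trans (by simp [entrySum, tensorId_apply])
    rw [sub_self]
    exact h0.trans_lt hε

/-- In a semigroup whose Lie wedge contains a generator `Λ` for which `e^Λ` has simple spectrum,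
the elements with simple spectrum are dense among the time-dependent Markovian ones. -/
theorem exists_hasOnlySimpleEigenvalues_of_mem_lieWedge {S : Set (Op ι)} (h1 : (1 : Op ι) ∈ S)
    (hmul : ∀ Φ₁ ∈ S, ∀ Φ₂ ∈ S, Φ₁ * Φ₂ ∈ S) {Λ : Op ι} (hΛ : Λ ∈ lieWedge S)
    (hsep : (LinearMap.charpoly (expOp Λ)).Separable) {Φ : Op ι}
    (hΦ : Φ ∈ timeDependentMarkovian S) {ε : ℝ} (hε : 0 < ε) :
    ∃ Φε ∈ timeDependentMarkovian S, HasOnlySimpleEigenvalues Φε ∧ diamondNorm (Φ - Φε) < ε := by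
  obtain ⟨Ls, hLs, hd⟩ := hΦ.2 ε hε
  have hlim : Tendsto (fun t : ℝ => (t : ℂ)) (𝓝[>] 0) (𝓝[≠] 0) := by
    refine tendsto_nhdsWithin_iff.2 ⟨?_, ?_⟩
    · exact (Complex.continuous_ofReal.tendsto' 0 0 (by simp)).mono_left nhdsWithin_le_nhds
    · filter_upwards [self_mem_nhdsWithin] with t ht
      simpa using ne_of_gt ht
  -- the endpoint `t = 1` has simple spectrum, hence so do all small `t ≠ 0`
  have e1 : ∀ᶠ t : ℝ in 𝓝[>] 0, (opMatrix (expPath Ls Λ t)).charpoly.Separable :=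
    hlim.eventually (eventually_separable_charpoly (t₁ := 1)
      (differentiable_opMatrix_expPath_apply Ls Λ)
      (by rwa [expPath_one, charpoly_opMatrix]) 0)
  have e2 : ∀ᶠ t : ℝ in 𝓝[>] 0, diamondNorm (expPath Ls Λ 0 - expPath Ls Λ t) <
      ε - diamondNorm (Φ - (Ls.map expOp).prod) := by
    have h : Tendsto (fun t : ℂ => diamondNorm (expPath Ls Λ 0 - expPath Ls Λ t)) (𝓝 0) (𝓝 0) :=
      tendsto_diamondNorm_sub fun X i j => (continuous_expPath_apply Ls Λ X i j).tendsto 0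
    exact hlim.eventually
      ((h.mono_left nhdsWithin_le_nhds).eventually (gt_mem_nhds (sub_pos.2 hd)))
  have e3 : ∀ᶠ t : ℝ in 𝓝[>] 0, t ∈ Set.Ioo (0 : ℝ) 1 := Ioo_mem_nhdsGT one_pos
  obtain ⟨t, ht1, ht2, ht3⟩ := (e1.and (e2.and e3)).exists
  refine ⟨expPath Ls Λ t, ?_, ?_, ?_⟩
  · have h := prod_expOp_mem_timeDependentMarkovian h1 hmul
      (Ls := Ls.map (fun L => (((1 - t : ℝ) : ℂ)) • L) ++ [(t : ℂ) • Λ]) (by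
        intro L hL
        rw [List.mem_append, List.mem_map, List.mem_singleton] at hL
        rcases hL with ⟨L, hL, rfl⟩ | rfl
        · exact smul_mem_lieWedge (hLs L hL) (sub_nonneg.2 ht3.2.le)
        · exact smul_mem_lieWedge hΛ ht3.1.le)
    simpa [expPath, Function.comp_def] using h
  · rw [charpoly_opMatrix] at ht1
    exact hasOnlySimpleEigenvalues_of_separable ht1
  · calc diamondNorm (Φ - expPath Ls Λ t)
        = diamondNorm ((Φ - (Ls.map expOp).prod) + (expPath Ls Λ 0 - expPath Ls Λ t)) := by
          rw [expPath_zero]; congr 1; abel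
      _ ≤ _ := diamondNorm_add_le _ _
      _ < ε := by linarith

/-! ### A generator in the Lie wedge -/

theorem pow_mem_of_mul_mem {S : Set (Op ι)} (h1 : (1 : Op ι) ∈ S)
    (hmul : ∀ Φ₁ ∈ S, ∀ Φ₂ ∈ S, Φ₁ * Φ₂ ∈ S) {Φ : Op ι} (hΦ : Φ ∈ S) (k : ℕ) : Φ ^ k ∈ S := by
  induction k with
  | zero => simpa
  | succ k ih => rw [pow_succ]; exact hmul _ ih _ hΦ

/-- `Φ - 1` generates a one-parameter semigroup in `S`, since `e^{t(Φ - 1)} = e^{-t} ∑ tᵏ Φᵏ / k!` is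
a limit of convex combinations of powers of `Φ`. -/
theorem sub_one_mem_lieWedge {S : Set (Op ι)} (hcl : IsNormClosed S) (hconv : Convex ℝ S)
    (h1 : (1 : Op ι) ∈ S) (hmul : ∀ Φ₁ ∈ S, ∀ Φ₂ ∈ S, Φ₁ * Φ₂ ∈ S) {Φ : Op ι} (hΦ : Φ ∈ S) :
    Φ - 1 ∈ lieWedge S := by
  intro t ht
  -- dividing the partial sums of `e^{tΦ}` by those of `e^t` yields convex combinations
  let s : ℕ → ℝ := fun m => ∑ k ∈ Finset.range (m + 1), t ^ k / k.factorial
  have hs : ∀ m, 0 < s m := fun m => by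
    refine Finset.sum_pos' (fun k _ => by positivity) ⟨0, by simp, by simp⟩
  have hslim : Tendsto s atTop (𝓝 (Real.exp t)) := by
    have h := NormedSpace.expSeries_div_hasSum_exp (𝔸 := ℝ) t
    rw [← Real.exp_eq_exp_ℝ] at h
    exact h.tendsto_sum_nat.comp (tendsto_add_atTop_nat 1)
  refine hcl.mem_of_tendsto
    (f := fun m => ∑ k ∈ Finset.range (m + 1), ((s m)⁻¹ * (t ^ k / k.factorial)) • Φ ^ k)
    (fun m => ?_) fun X i j => ?_
  · refine hconv.sum_mem (fun k _ => ?_) ?_ fun k _ => pow_mem_of_mul_mem h1 hmul hΦ k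
    · have := hs m
      positivity
    · rw [← Finset.mul_sum]
      exact inv_mul_cancel₀ (hs m).ne'
  · have hsum := hasSum_expOp ((t : ℂ) • Φ) X
    have hsum' := (Pi.hasSum.1 (Pi.hasSum.1 hsum i) j).tendsto_sum_nat.comp
      (tendsto_add_atTop_nat 1)
    have hlim := ((Complex.continuous_ofReal.tendsto _).comp
      (hslim.inv₀ (Real.exp_pos t).ne')).mul hsum'
    rw [expOp_smul_sub_one]
    have hexp : (((Real.exp t)⁻¹ : ℝ) : ℂ) = Complex.exp (-t) := by
      rw [← Real.exp_neg]; simp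
    rw [hexp] at hlim
    refine hlim.congr fun m => ?_
    simp only [Function.comp_apply, LinearMap.sum_apply, Matrix.sum_apply, Finset.mul_sum]
    refine Finset.sum_congr rfl fun k _ => ?_
    simp [smul_pow, Complex.real_smul]
    ring

/-! ### The spectrum of `Ψ` -/

/-- A map with as many distinct eigenvalues as the dimension has a separable characteristic
polynomial. -/
theorem separable_charpoly_of_eigenvectors {ι : Type} [Fintype ι] [DecidableEq ι] {Φ : Op ι}
    {μ : ι × ι → ℂ} (hμ : Function.Injective μ) {v : ι × ι → Mat ι} (hv : ∀ p, v p ≠ 0)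
    (h : ∀ p, Φ (v p) = μ p • v p) : (LinearMap.charpoly Φ).Separable := by
  have hroot : ∀ p, (LinearMap.charpoly Φ).IsRoot (μ p) := fun p =>
    (Module.End.hasEigenvalue_iff_isRoot_charpoly Φ (μ p)).1
      (Module.End.hasEigenvalue_of_hasEigenvector
        ⟨Module.End.mem_eigenspace_iff.2 (h p), hv p⟩)
  have hdvd : ∏ p, (Polynomial.X - Polynomial.C (μ p)) ∣ LinearMap.charpoly Φ :=
    Finset.prod_dvd_of_coprime
      (fun p _ q _ hpq => Polynomial.pairwise_coprime_X_sub_C hμ hpq)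
      fun p _ => Polynomial.dvd_iff_isRoot.2 (hroot p)
  have heq := Polynomial.eq_of_monic_of_dvd_of_natDegree_le
    (Polynomial.monic_prod_of_monic _ _ fun p _ => Polynomial.monic_X_sub_C (μ p))
    (LinearMap.charpoly_monic Φ) hdvd (by
      rw [LinearMap.charpoly_natDegree, Polynomial.natDegree_prod_of_monic _ _
        fun p _ => Polynomial.monic_X_sub_C (μ p)]
      simp [Module.finrank_matrix])
  rw [heq]
  exact Polynomial.separable_prod_X_sub_C_iff.2 hμ

theorem expOp_apply_eigenvector {ι : Type} [Fintype ι] [DecidableEq ι] {L : Op ι} {μ : ℂ}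
    {X : Mat ι} (h : L X = μ • X) : expOp L X = Complex.exp μ • X := by
  have hk : ∀ k : ℕ, (L ^ k) X = μ ^ k • X := fun k => by
    induction k with
    | zero => simp
    | succ k ih => rw [pow_succ', Module.End.mul_apply, ih, map_smul, h, smul_smul, pow_succ]
  have h1 := hasSum_expOp L X
  have h2 := NormedSpace.expSeries_div_hasSum_exp (𝔸 := ℂ) μ
  rw [← Complex.exp_eq_exp_ℂ] at h2
  have h3 : HasSum (fun k : ℕ => ((k.factorial : ℂ)⁻¹) • (L ^ k) X) (Complex.exp μ • X) := by
    refine Pi.hasSum.2 fun i => Pi.hasSum.2 fun j => ?_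
    refine (h2.mul_right (X i j)).congr_fun ?_
    intro k
    simp [hk]
    ring
  exact h1.unique h3

theorem Psi_apply (n : ℕ) (X : Mat (Fin n)) (j k : Fin n) :
    Psi n X j k = if j = k then ∑ m, shiftAverage n j m * X m m
      else if j < k then
        Complex.I / ((2 : ℂ) ^ (j.val + 1) * (3 : ℂ) ^ (k.val + 1)) * X j k
      else
        -Complex.I / ((2 : ℂ) ^ (k.val + 1) * (3 : ℂ) ^ (j.val + 1)) * X j k := rfl

theorem sum_shiftAverage_mul (n : ℕ) (x : Fin n → ℂ) (j : Fin n) :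
    ∑ m, shiftAverage n j m * x m = (x j + x (finRotate n j)) / 2 := by
  simp only [shiftAverage, cyclicShift, Matrix.smul_apply, Matrix.add_apply, Matrix.one_apply,
    Matrix.of_apply, smul_eq_mul, mul_assoc, add_mul, ite_mul, one_mul, zero_mul]
  rw [← Finset.mul_sum, Finset.sum_add_distrib]
  simp
  ring

/-- The primitive `n`-th root of unity `ω = e^{2πi/n}` (equal to `1` for `n = 0`). -/
def rootOfUnity (n : ℕ) : ℂ := Complex.exp (2 * Real.pi * Complex.I / n)

theorem norm_rootOfUnity (n : ℕ) : ‖rootOfUnity n‖ = 1 := by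
  rw [rootOfUnity, show (2 * Real.pi * Complex.I / n : ℂ) =
    ((2 * Real.pi / n : ℝ) : ℂ) * Complex.I by push_cast; ring]
  exact Complex.norm_exp_ofReal_mul_I _

/-- The vector `m ↦ ω^{jm}` is an eigenvector of the cyclic shift. -/
theorem rootOfUnity_pow_mul_finRotate (n : ℕ) (j m : Fin n) :
    rootOfUnity n ^ (j.val * (finRotate n m).val) =
      rootOfUnity n ^ j.val * rootOfUnity n ^ (j.val * m.val) := by
  obtain _ | n := n
  · exact j.elim0
  have h1 : rootOfUnity (n + 1) ^ (n + 1) = 1 :=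
    (Complex.isPrimitiveRoot_exp (n + 1) (by lia)).pow_eq_one
  rw [finRotate_apply, Fin.val_add_one, ← pow_add]
  split_ifs with h
  -- at the wrap-around `m = n` the exponents differ by the multiple `(n + 1) * j` of `n + 1`
  · rw [h, Fin.val_last, show j.val + j.val * n = (n + 1) * j.val by ring, pow_mul _ (n + 1), h1]
    simp
  · congr 1; ring

/-- The eigenvalues of `Ψ`. The pairs `(j, j)` index those of the circulant matrix `A`. -/
def psiEigenvalue (n : ℕ) (p : Fin n × Fin n) : ℂ :=
  if p.1 = p.2 then (1 + rootOfUnity n ^ p.1.val) / 2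
  else if p.1 < p.2 then
    Complex.I / ((2 : ℂ) ^ (p.1.val + 1) * (3 : ℂ) ^ (p.2.val + 1))
  else -Complex.I / ((2 : ℂ) ^ (p.2.val + 1) * (3 : ℂ) ^ (p.1.val + 1))

/-- The eigenvectors of `Ψ`: off-diagonal matrix units, and diagonal matrices whose entries form
the discrete Fourier basis. -/
def psiEigenvector (n : ℕ) (p : Fin n × Fin n) : Mat (Fin n) :=
  if p.1 = p.2 then Matrix.diagonal fun m => rootOfUnity n ^ (p.1.val * m.val)
  else Matrix.single p.1 p.2 1

theorem psiEigenvector_ne_zero (n : ℕ) (p : Fin n × Fin n) : psiEigenvector n p ≠ 0 := by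
  intro h
  unfold psiEigenvector at h
  split_ifs at h
  · have := congrFun (congrFun h p.1) p.1
    simp [rootOfUnity, Complex.exp_ne_zero] at this
  · simpa using congrFun (congrFun h p.1) p.2

theorem Psi_psiEigenvector (n : ℕ) (p : Fin n × Fin n) :
    Psi n (psiEigenvector n p) = psiEigenvalue n p • psiEigenvector n p := by
  ext a b
  rw [Psi_apply, sum_shiftAverage_mul, Matrix.smul_apply, smul_eq_mul]
  unfold psiEigenvector psiEigenvalue
  by_cases hp : p.1 = p.2
  · simp only [hp, if_true]
    by_cases hab : a = b
    · subst hab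
      simp only [Matrix.diagonal_apply_eq, if_true, rootOfUnity_pow_mul_finRotate]
      ring
    · simp [hab]
  · simp only [hp, if_false]
    by_cases hab : a = b
    · subst hab
      have h1 : ∀ m, ¬ (p.1 = m ∧ p.2 = m) := fun m h => hp (h.1.trans h.2.symm)
      simp [h1]
    · by_cases h : p.1 = a ∧ p.2 = b
      · obtain ⟨rfl, rfl⟩ := h
        simp [hp]
      · simp [h, hab]

theorem norm_psiEigenvalue_le (n : ℕ) (p : Fin n × Fin n) : ‖psiEigenvalue n p‖ ≤ 1 := by
  have hk : ∀ a b : ℕ, ((2 : ℝ) ^ (a + 1) * 3 ^ (b + 1))⁻¹ ≤ 1 := fun a b =>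
    inv_le_one_of_one_le₀ (one_le_mul_of_one_le_of_one_le (one_le_pow₀ (by norm_num))
      (one_le_pow₀ (by norm_num)))
  unfold psiEigenvalue
  split_ifs
  · rw [norm_div, Complex.norm_ofNat, div_le_one (by norm_num)]
    refine (norm_add_le _ _).trans ?_
    rw [norm_pow, norm_rootOfUnity]
    norm_num
  · simpa using hk p.1 p.2
  · simpa using hk p.2 p.1

theorem two_pow_mul_three_pow_inj {a b c d : ℕ} (h : 2 ^ a * 3 ^ b = 2 ^ c * 3 ^ d) :
    a = c ∧ b = d := by
  have h2 := congrArg (padicValNat 2) h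
  have h3 := congrArg (padicValNat 3) h
  have : Fact (Nat.Prime 3) := ⟨Nat.prime_three⟩
  have e23 : padicValNat 2 3 = 0 := padicValNat.eq_zero_of_not_dvd (by norm_num)
  have e32 : padicValNat 3 2 = 0 := padicValNat.eq_zero_of_not_dvd (by norm_num)
  simp only [padicValNat.mul (pow_ne_zero _ two_ne_zero) (pow_ne_zero _ three_ne_zero),
    padicValNat.pow, padicValNat.self one_lt_two, e23, e32,
    padicValNat.self (by norm_num : 1 < 3)] at h2 h3
  lia

/-- The off-diagonal eigenvalues are nonzero and purely imaginary; their imaginary part determines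
the index because `2ʲ3ᵏ` does. -/
theorem psiEigenvalue_off_diagonal {n : ℕ} {p : Fin n × Fin n} (hp : p.1 ≠ p.2) :
    (psiEigenvalue n p).re = 0 ∧ (psiEigenvalue n p).im =
      (if p.1 < p.2 then 1 else -1) *
        (((2 ^ (min p.1.val p.2.val + 1) * 3 ^ (max p.1.val p.2.val + 1) : ℕ) : ℝ))⁻¹ := by
  have key : ∀ a b : ℕ, Complex.I / ((2 : ℂ) ^ a * (3 : ℂ) ^ b) =
      (((((2 ^ a * 3 ^ b : ℕ) : ℝ))⁻¹ : ℝ) : ℂ) * Complex.I := fun a b => by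
    push_cast; ring
  unfold psiEigenvalue
  rw [if_neg hp]
  split_ifs with h
  · have h' : p.1.val < p.2.val := h
    rw [key, min_eq_left h'.le, max_eq_right h'.le, Complex.re_ofReal_mul, Complex.im_ofReal_mul]
    simp only [Complex.I_re, Complex.I_im, mul_zero, mul_one, one_mul, and_self]
  · have h' : p.2.val ≤ p.1.val := not_lt.1 h
    rw [neg_div, key, min_eq_right h', max_eq_left h', Complex.neg_re, Complex.neg_im,
      Complex.re_ofReal_mul, Complex.im_ofReal_mul]
    simp only [Complex.I_re, Complex.I_im, mul_zero, mul_one, neg_mul, one_mul, neg_zero, and_self]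

/-- A diagonal eigenvalue `(1 + w) / 2` with `‖w‖ = 1` is purely imaginary only if it is `0`. -/
theorem psiEigenvalue_diagonal_ne {n : ℕ} {p q : Fin n × Fin n} (hp : p.1 = p.2)
    (hq : q.1 ≠ q.2) : psiEigenvalue n p ≠ psiEigenvalue n q := by
  intro h
  obtain ⟨hre, him⟩ := psiEigenvalue_off_diagonal hq
  rw [← h] at hre him
  have him0 : (psiEigenvalue n p).im ≠ 0 := by
    rw [him]
    refine mul_ne_zero (by split_ifs <;> norm_num) (inv_ne_zero ?_)
    exact_mod_cast (by positivity : (0 : ℕ) < _).ne'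
  set w := rootOfUnity n ^ p.1.val with hw
  have hval : psiEigenvalue n p = (1 + w) / 2 := by simp [psiEigenvalue, hp, hw]
  have hnorm : ‖w‖ = 1 := by
    rw [hw, norm_pow, norm_rootOfUnity, one_pow]
  have hsq : w.re * w.re + w.im * w.im = 1 := by
    rw [← Complex.normSq_apply, Complex.normSq_eq_norm_sq, hnorm, one_pow]
  have h1 : (psiEigenvalue n p).re = (1 + w.re) / 2 := by
    rw [hval, show (1 + w) / 2 = (1 + w) / ((2 : ℝ) : ℂ) by norm_num, Complex.div_ofReal_re]
    simp
  have h2 : (psiEigenvalue n p).im = w.im / 2 := by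
    rw [hval, show (1 + w) / 2 = (1 + w) / ((2 : ℝ) : ℂ) by norm_num, Complex.div_ofReal_im]
    simp
  rw [h1] at hre
  have hre' : w.re = -1 := by linarith
  rw [hre'] at hsq
  refine him0 ?_
  rw [h2]
  have : w.im = 0 := by nlinarith
  simp [this]

theorem psiEigenvalue_injective (n : ℕ) : Function.Injective (psiEigenvalue n) := by
  intro p q h
  by_cases hp : p.1 = p.2
  · by_cases hq : q.1 = q.2
    · have hn : n ≠ 0 := by have := p.1.2; lia
      have hpow : rootOfUnity n ^ p.1.val = rootOfUnity n ^ q.1.val := by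
        simp only [psiEigenvalue, hp, hq, if_true] at h
        rw [hp, hq]
        linear_combination 2 * h
      have := (Complex.isPrimitiveRoot_exp n hn).pow_inj p.1.2 q.1.2 hpow
      have h1 : p.1 = q.1 := Fin.ext this
      exact Prod.ext h1 (by rw [← hp, ← hq, h1])
    · exact absurd h (psiEigenvalue_diagonal_ne hp hq)
  · by_cases hq : q.1 = q.2
    · exact absurd h.symm (psiEigenvalue_diagonal_ne hq hp)
    · have hpi := (psiEigenvalue_off_diagonal hp).2
      have hqi := (psiEigenvalue_off_diagonal hq).2
      rw [h, hqi] at hpi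
      have hpos : ∀ a b : ℕ, (0 : ℝ) < (((2 ^ a * 3 ^ b : ℕ) : ℝ))⁻¹ := fun a b => by positivity
      have P := hpos (min p.1.val p.2.val + 1) (max p.1.val p.2.val + 1)
      have Q := hpos (min q.1.val q.2.val + 1) (max q.1.val q.2.val + 1)
      have hiff : p.1 < p.2 ↔ q.1 < q.2 := by
        split_ifs at hpi with h1 h2 h2
        · simp [h1, h2]
        · linarith
        · linarith
        · simp [h1, h2]
      have hinv : (((2 ^ (min q.1.val q.2.val + 1) * 3 ^ (max q.1.val q.2.val + 1) : ℕ) : ℝ))⁻¹ =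
          (((2 ^ (min p.1.val p.2.val + 1) * 3 ^ (max p.1.val p.2.val + 1) : ℕ) : ℝ))⁻¹ := by
        split_ifs at hpi with h1 h2 h2 <;> linarith
      have hnat := two_pow_mul_three_pow_inj (Nat.cast_injective (inv_injective hinv))
      rw [Fin.lt_def, Fin.lt_def] at hiff
      refine Prod.ext (Fin.ext ?_) (Fin.ext ?_) <;> lia

/-- The eigenvalues of `Ψ` lie in the closed unit disc, on which `exp` is injective. -/
theorem separable_charpoly_expOp_Psi_sub_one (n : ℕ) :
    (LinearMap.charpoly (expOp (Psi n - 1))).Separable := by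
  refine separable_charpoly_of_eigenvectors (μ := fun p => Complex.exp (psiEigenvalue n p - 1))
    (fun p q h => ?_) (psiEigenvector_ne_zero n) fun p => expOp_apply_eigenvector ?_
  · have him : ∀ p, |(psiEigenvalue n p).im| ≤ 1 := fun p =>
      (Complex.abs_im_le_norm _).trans (norm_psiEigenvalue_le n p)
    have hp := abs_le.1 (him p)
    have hq := abs_le.1 (him q)
    have hπ := Real.pi_gt_three
    have := Complex.exp_inj_of_neg_pi_lt_of_le_pi (x := psiEigenvalue n p - 1)
      (y := psiEigenvalue n q - 1) (by simp; linarith) (by simp; linarith) (by simp; linarith)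
      (by simp; linarith) h
    exact psiEigenvalue_injective n (sub_left_injective this)
  · rw [LinearMap.sub_apply, Psi_psiEigenvector, Module.End.one_apply, sub_smul, one_smul]

/-! ### Closed convex semigroups of maps -/

section Semigroup

variable {ι : Type} [Fintype ι] [DecidableEq ι]

/-- `S` is a closed convex set of maps which contains the identity and is closed under
composition. -/
structure IsClosedConvexSemigroup (S : Set (Op ι)) : Prop where
  isNormClosed : IsNormClosed S
  convex : Convex ℝ S
  one_mem : (1 : Op ι) ∈ S
  mul_mem : ∀ Φ₁ ∈ S, ∀ Φ₂ ∈ S, Φ₁ * Φ₂ ∈ S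

theorem IsClosedConvexSemigroup.inter {S T : Set (Op ι)} (hS : IsClosedConvexSemigroup S)
    (hT : IsClosedConvexSemigroup T) : IsClosedConvexSemigroup (S ∩ T) where
  isNormClosed Φ h :=
    ⟨hS.isNormClosed Φ fun ε hε => (h ε hε).imp fun _ hΘ => ⟨hΘ.1.1, hΘ.2⟩,
      hT.isNormClosed Φ fun ε hε => (h ε hε).imp fun _ hΘ => ⟨hΘ.1.2, hΘ.2⟩⟩
  convex := hS.convex.inter hT.convex
  one_mem := ⟨hS.one_mem, hT.one_mem⟩
  mul_mem _ h₁ _ h₂ := ⟨hS.mul_mem _ h₁.1 _ h₂.1, hT.mul_mem _ h₁.2 _ h₂.2⟩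

theorem IsClosedConvexSemigroup.iInter {α : Type*} {S : α → Set (Op ι)}
    (hS : ∀ a, IsClosedConvexSemigroup (S a)) : IsClosedConvexSemigroup (⋂ a, S a) where
  isNormClosed Φ h := Set.mem_iInter.2 fun a => (hS a).isNormClosed Φ fun ε hε =>
    (h ε hε).imp fun _ hΘ => ⟨Set.mem_iInter.1 hΘ.1 a, hΘ.2⟩
  convex := convex_iInter fun a => (hS a).convex
  one_mem := Set.mem_iInter.2 fun a => (hS a).one_mem
  mul_mem _ h₁ _ h₂ := Set.mem_iInter.2 fun a =>
    (hS a).mul_mem _ (Set.mem_iInter.1 h₁ a) _ (Set.mem_iInter.1 h₂ a)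

/-- The ampliation `Φ ↦ Φ ⊗ id` is a continuous unital algebra homomorphism. -/
theorem IsClosedConvexSemigroup.preimage_tensorId (κ : Type) [Fintype κ] [DecidableEq κ]
    {S : Set (Op (ι × κ))} (hS : IsClosedConvexSemigroup S) :
    IsClosedConvexSemigroup (tensorId κ ⁻¹' S : Set (Op ι)) where
  isNormClosed := isNormClosed_of_seq fun _f _Φ hf h =>
    hS.isNormClosed.mem_of_tendsto hf fun _X p q => h _ p.1 q.1
  convex := by
    intro Φ₁ h₁ Φ₂ h₂ a b ha hb hab
    exact hS.convex h₁ h₂ ha hb hab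
  one_mem := hS.one_mem
  mul_mem _ h₁ _ h₂ := hS.mul_mem _ h₁ _ h₂

theorem posSemidef_of_tendsto {κ : Type} [Fintype κ] {M : ℕ → Mat κ} {A : Mat κ} (hM : ∀ m, (M m).PosSemidef)
    (h : ∀ i j, Tendsto (fun m => M m i j) atTop (𝓝 (A i j))) : A.PosSemidef := by
  refine Matrix.PosSemidef.of_dotProduct_mulVec_nonneg ?_ fun x => ?_
  · ext i j
    have h1 : Tendsto (fun m => M m i j) atTop (𝓝 (star (A j i))) := by
      refine (h j i).star.congr fun m => ?_
      exact (hM m).1.apply i j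
    exact tendsto_nhds_unique h1 (h i j)
  · refine ge_of_tendsto' (x := atTop) (f := fun m => star x ⬝ᵥ (M m *ᵥ x)) ?_
      fun m => (hM m).dotProduct_mulVec_nonneg x
    exact tendsto_finsetSum _ fun i _ => Tendsto.const_mul _
      (tendsto_finsetSum _ fun j _ => (h i j).mul_const _)

theorem isClosedConvexSemigroup_isPositiveMap :
    IsClosedConvexSemigroup {Φ : Op ι | IsPositiveMap Φ} where
  isNormClosed := isNormClosed_of_seq fun _f _Φ hf h A hA =>
    posSemidef_of_tendsto (fun m => hf m A hA) (h A)
  convex := fun _ h₁ _ h₂ _ _ ha hb _ A hA => ((h₁ A hA).smul ha).add ((h₂ A hA).smul hb)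
  one_mem := fun _ hA => hA
  mul_mem := fun _ h₁ _ h₂ A hA => h₁ _ (h₂ A hA)

theorem isClosedConvexSemigroup_isTracePreserving :
    IsClosedConvexSemigroup {Φ : Op ι | IsTracePreserving Φ} where
  isNormClosed := isNormClosed_of_seq fun f Φ hf h A => by
    have h1 : Tendsto (fun m => (f m A).trace) atTop (𝓝 (Φ A).trace) :=
      tendsto_finsetSum _ fun i _ => h A i i
    simp only [fun m => hf m A] at h1
    exact tendsto_nhds_unique h1 tendsto_const_nhds
  convex := fun Φ h₁ Θ h₂ a b _ _ hab A => by
    rw [LinearMap.add_apply, LinearMap.smul_apply, LinearMap.smul_apply, Matrix.trace_add,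
      Matrix.trace_smul, Matrix.trace_smul, h₁ A, h₂ A, ← add_smul, hab, one_smul]
  one_mem := fun _ => rfl
  mul_mem := fun _ h₁ _ h₂ A => (h₁ _).trans (h₂ A)

theorem isClosedConvexSemigroup_apply_one_eq_one :
    IsClosedConvexSemigroup {Φ : Op ι | Φ 1 = 1} where
  isNormClosed := isNormClosed_of_seq fun f Φ hf h => by
    ext i j
    have h1 := h 1 i j
    simp only [fun m => show f m 1 = 1 from hf m] at h1
    exact tendsto_nhds_unique h1 tendsto_const_nhds
  convex := fun Φ h₁ Θ h₂ a b _ _ hab => by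
    have h₁' : Φ 1 = 1 := h₁
    have h₂' : Θ 1 = 1 := h₂
    rw [Set.mem_ofPred_eq, LinearMap.add_apply, LinearMap.smul_apply, LinearMap.smul_apply, h₁', h₂',
      ← add_smul, hab, one_smul]
  one_mem := rfl
  mul_mem := fun Φ h₁ Θ h₂ => by
    have h₂' : Θ 1 = 1 := h₂
    rw [Set.mem_ofPred_eq, Module.End.mul_apply, h₂']
    exact h₁

theorem isClosedConvexSemigroup_isCompletelyPositive :
    IsClosedConvexSemigroup {Φ : Op ι | IsCompletelyPositive Φ} := by
  have h := IsClosedConvexSemigroup.iInter fun k : ℕ =>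
    isClosedConvexSemigroup_isPositiveMap.preimage_tensorId (ι := ι) (Fin k)
  convert h
  ext Φ
  simp [IsCompletelyPositive]

theorem isClosedConvexSemigroup_PTP (n : ℕ) : IsClosedConvexSemigroup (PTP n) :=
  isClosedConvexSemigroup_isPositiveMap.inter isClosedConvexSemigroup_isTracePreserving

theorem isClosedConvexSemigroup_CPTP (n : ℕ) : IsClosedConvexSemigroup (CPTP n) :=
  isClosedConvexSemigroup_isCompletelyPositive.inter isClosedConvexSemigroup_isTracePreserving

theorem isClosedConvexSemigroup_UnitalCPTP (n : ℕ) : IsClosedConvexSemigroup (UnitalCPTP n) :=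
  (isClosedConvexSemigroup_CPTP n).inter isClosedConvexSemigroup_apply_one_eq_one

/-- Complete positivity is applied with a one-dimensional second tensor factor. -/
theorem IsCompletelyPositive.isPositiveMap {Φ : Op ι} (h : IsCompletelyPositive Φ) :
    IsPositiveMap Φ := by
  intro A hA
  have h1 := h 1 (A.submatrix Prod.fst Prod.fst) (hA.submatrix _)
  exact h1.submatrix fun i => (i, 0)

end Semigroup

/-! ### `Ψ` is a unital channel -/

/-- The Schur multiplier by which `Ψ` acts on off-diagonal entries, with `1/2` on the diagonal. -/
def psiMultiplier (n : ℕ) : Mat (Fin n) :=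
  Matrix.of fun j k =>
    if j = k then 1 / 2
    else if j < k then Complex.I / ((2 : ℂ) ^ (j.val + 1) * (3 : ℂ) ^ (k.val + 1))
    else -Complex.I / ((2 : ℂ) ^ (k.val + 1) * (3 : ℂ) ^ (j.val + 1))

theorem isHermitian_psiMultiplier (n : ℕ) : (psiMultiplier n).IsHermitian := by
  ext j k
  simp only [psiMultiplier, Matrix.conjTranspose_apply, Matrix.of_apply]
  rcases lt_trichotomy j k with h | rfl | h
  · simp [h.ne, h.ne', h, h.not_gt]
  · simp
  · simp [h.ne, h.ne', h, h.not_gt]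

theorem norm_psiMultiplier_le {n : ℕ} {j k : Fin n} (h : j ≠ k) :
    ‖psiMultiplier n j k‖ ≤ (1 / 2) ^ (k.val + 2) := by
  have key : ∀ a b c : ℕ, c + 2 ≤ (a + 1) + (b + 1) →
      ((2 : ℝ) ^ (a + 1) * 3 ^ (b + 1))⁻¹ ≤ (1 / 2) ^ (c + 2) := by
    intro a b c hc
    rw [one_div, inv_pow]
    refine inv_anti₀ (by positivity) ?_
    calc (2 : ℝ) ^ (c + 2) ≤ 2 ^ ((a + 1) + (b + 1)) := pow_le_pow_right₀ (by norm_num) hc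
      _ = 2 ^ (a + 1) * 2 ^ (b + 1) := pow_add _ _ _
      _ ≤ 2 ^ (a + 1) * 3 ^ (b + 1) := by gcongr; norm_num
  simp only [psiMultiplier, Matrix.of_apply, if_neg h]
  split_ifs with hjk
  · simpa using key j k k (by lia)
  · simpa using key k j k (by lia)

theorem sum_half_pow (n : ℕ) :
    ∑ k : Fin n, (1 / 2 : ℝ) ^ (k.val + 2) = 1 / 2 - (1 / 2) ^ (n + 1) := by
  rw [Fin.sum_univ_eq_sum_range fun k => (1 / 2 : ℝ) ^ (k + 2)]
  induction n with
  | zero => norm_num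
  | succ n ih => rw [Finset.sum_range_succ, ih]; ring

/-- The multiplier is positive semidefinite because it is Hermitian and diagonally dominant. -/
theorem posSemidef_psiMultiplier (n : ℕ) : (psiMultiplier n).PosSemidef := by
  rw [(isHermitian_psiMultiplier n).posSemidef_iff_eigenvalues_nonneg]
  intro i
  set h := isHermitian_psiMultiplier n
  have hev : Module.End.HasEigenvalue (Matrix.toLin' (psiMultiplier n)) (h.eigenvalues i : ℂ) := by
    refine Module.End.hasEigenvalue_of_hasEigenvector (x := ⇑(h.eigenvectorBasis i))
      ⟨Module.End.mem_eigenspace_iff.2 ?_, ?_⟩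
    · rw [Matrix.toLin'_apply, h.mulVec_eigenvectorBasis i]
      rfl
    · intro h0
      exact h.eigenvectorBasis.orthonormal.ne_zero i (by ext k; exact congrFun h0 k)
  -- Gershgorin: every eigenvalue lies within `1 / 2` of a diagonal entry, which is `1 / 2`
  obtain ⟨k, hk⟩ := eigenvalue_mem_ball hev
  have hsum : ∑ j ∈ Finset.univ.erase k, ‖psiMultiplier n k j‖ ≤ 1 / 2 := by
    calc ∑ j ∈ Finset.univ.erase k, ‖psiMultiplier n k j‖
        ≤ ∑ j ∈ Finset.univ.erase k, (1 / 2 : ℝ) ^ (j.val + 2) :=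
          Finset.sum_le_sum fun j hj => norm_psiMultiplier_le (Finset.ne_of_mem_erase hj).symm
      _ ≤ ∑ j : Fin n, (1 / 2 : ℝ) ^ (j.val + 2) :=
          Finset.sum_le_sum_of_subset_of_nonneg (Finset.erase_subset _ _)
            fun _ _ _ => by positivity
      _ ≤ 1 / 2 := by
          rw [sum_half_pow]
          have : (0 : ℝ) ≤ (1 / 2) ^ (n + 1) := by positivity
          linarith
  have hd : psiMultiplier n k k = ((1 / 2 : ℝ) : ℂ) := by simp [psiMultiplier]
  rw [Metric.mem_closedBall, hd, Complex.dist_eq, ← Complex.ofReal_sub, Complex.norm_real,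
    Real.norm_eq_abs] at hk
  have := (abs_le.1 (hk.trans hsum)).1
  simp only [Pi.zero_apply]
  linarith

/-- `Ψ ⊗ id` is the sum of two Schur multiplications with positive semidefinite matrices, the
second one preceded by a cyclic shift of the first tensor factor. -/
theorem tensorId_Psi (n : ℕ) (κ : Type) [Fintype κ] [DecidableEq κ] (X : Mat (Fin n × κ)) :
    tensorId κ (Psi n) X =
      (psiMultiplier n).submatrix Prod.fst Prod.fst ⊙ X +
      ((1 / 2 : ℝ) • (1 : Mat (Fin n))).submatrix Prod.fst Prod.fst ⊙
        X.submatrix (Prod.map (finRotate n) id) (Prod.map (finRotate n) id) := by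
  ext ⟨a, x⟩ ⟨b, y⟩
  rw [tensorId_apply, Psi_apply, sum_shiftAverage_mul n fun m =>
    (Matrix.of fun i j => X (i, x) (j, y)) m m]
  simp only [Matrix.add_apply, Matrix.hadamard_apply, Matrix.submatrix_apply, psiMultiplier,
    Matrix.of_apply, Matrix.smul_apply, Matrix.one_apply, Prod.map_apply, id]
  by_cases h : a = b
  · subst h
    simp only [if_true, Complex.real_smul]
    push_cast
    ring
  · simp [h]

theorem isCompletelyPositive_Psi (n : ℕ) : IsCompletelyPositive (Psi n) := by
  intro k X hX
  rw [tensorId_Psi]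
  have h1 : ((1 / 2 : ℝ) • (1 : Mat (Fin n))).PosSemidef :=
    Matrix.PosSemidef.one.smul (by norm_num)
  exact (((posSemidef_psiMultiplier n).submatrix _).hadamard hX).add
    ((h1.submatrix _).hadamard (hX.submatrix _))

theorem isTracePreserving_Psi (n : ℕ) : IsTracePreserving (Psi n) := by
  intro A
  have h : ∀ j, Psi n A j j = (A j j + A (finRotate n j) (finRotate n j)) / 2 := fun j => by
    rw [Psi_apply, if_pos rfl, sum_shiftAverage_mul n fun m => A m m]
  simp only [Matrix.trace, Matrix.diag_apply, h]
  rw [← Finset.sum_div, Finset.sum_add_distrib, Equiv.sum_comp (finRotate n) fun j => A j j]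
  ring

theorem Psi_one (n : ℕ) : Psi n 1 = 1 := by
  ext j k
  rw [Psi_apply, sum_shiftAverage_mul n fun m => (1 : Mat (Fin n)) m m]
  by_cases h : j = k
  · subst h
    simp
  · simp [h]

theorem Psi_mem_UnitalCPTP (n : ℕ) : Psi n ∈ UnitalCPTP n :=
  ⟨⟨isCompletelyPositive_Psi n, isTracePreserving_Psi n⟩, Psi_one n⟩

theorem Psi_mem_PTP (n : ℕ) : Psi n ∈ PTP n :=
  ⟨(isCompletelyPositive_Psi n).isPositiveMap, isTracePreserving_Psi n⟩

/-! ### Density of simple spectrum -/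

theorem IsClosedConvexSemigroup.exists_hasOnlySimpleEigenvalues {n : ℕ} {S : Set (Op (Fin n))}
    (hS : IsClosedConvexSemigroup S) (hΨ : Psi n ∈ S) :
    ∀ Φ ∈ timeDependentMarkovian S, ∀ ε : ℝ, 0 < ε →
      ∃ Φε ∈ timeDependentMarkovian S, HasOnlySimpleEigenvalues Φε ∧ diamondNorm (Φ - Φε) < ε :=
  fun _ hΦ _ hε => exists_hasOnlySimpleEigenvalues_of_mem_lieWedge hS.one_mem hS.mul_mem
    (sub_one_mem_lieWedge hS.isNormClosed hS.convex hS.one_mem hS.mul_mem hΨ)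
    (separable_charpoly_expOp_Psi_sub_one n) hΦ hε

end QChannel

end

theorem mainTheorem7 (n : ℕ) :
    -- time-dependent Markovian channels
    (∀ Φ ∈ QChannel.MCPTP n, ∀ ε : ℝ, 0 < ε →
      ∃ Φε ∈ QChannel.MCPTP n, QChannel.HasOnlySimpleEigenvalues Φε ∧
        QChannel.diamondNorm (Φ - Φε) < ε) ∧
    -- any closed convex semigroup containing the identity and `Ψ`
    (∀ S : Set (QChannel.Op (Fin n)),
      QChannel.IsNormClosed S → Convex ℝ S → (1 : QChannel.Op (Fin n)) ∈ S →
      (∀ Φ₁ ∈ S, ∀ Φ₂ ∈ S, Φ₁ * Φ₂ ∈ S) → QChannel.Psi n ∈ S →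
      ∀ Φ ∈ QChannel.timeDependentMarkovian S, ∀ ε : ℝ, 0 < ε →
        ∃ Φε ∈ QChannel.timeDependentMarkovian S, QChannel.HasOnlySimpleEigenvalues Φε ∧
          QChannel.diamondNorm (Φ - Φε) < ε) ∧
    -- in particular, the positive trace-preserving maps
    (∀ Φ ∈ QChannel.timeDependentMarkovian (QChannel.PTP n), ∀ ε : ℝ, 0 < ε →
      ∃ Φε ∈ QChannel.timeDependentMarkovian (QChannel.PTP n),
        QChannel.HasOnlySimpleEigenvalues Φε ∧ QChannel.diamondNorm (Φ - Φε) < ε) ∧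
    -- in particular, the unital channels
    (∀ Φ ∈ QChannel.timeDependentMarkovian (QChannel.UnitalCPTP n), ∀ ε : ℝ, 0 < ε →
      ∃ Φε ∈ QChannel.timeDependentMarkovian (QChannel.UnitalCPTP n),
        QChannel.HasOnlySimpleEigenvalues Φε ∧ QChannel.diamondNorm (Φ - Φε) < ε) := by
  exact ⟨(QChannel.isClosedConvexSemigroup_CPTP n).exists_hasOnlySimpleEigenvalues
      (QChannel.Psi_mem_UnitalCPTP n).1,
    fun _ hcl hconv hone hmul hΨ =>
      QChannel.IsClosedConvexSemigroup.exists_hasOnlySimpleEigenvalues ⟨hcl, hconv, hone, hmul⟩ hΨ,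
    (QChannel.isClosedConvexSemigroup_PTP n).exists_hasOnlySimpleEigenvalues
      (QChannel.Psi_mem_PTP n),
    (QChannel.isClosedConvexSemigroup_UnitalCPTP n).exists_hasOnlySimpleEigenvalues
      (QChannel.Psi_mem_UnitalCPTP n)⟩
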